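/- Consider a society of agents $\{1,\dots,n\}$ whose beliefs $x(k)\in\mathbb{R}^n$ evolve in discrete time slots. In each slot an agent $i$ is chosen uniformly at random and meets agent $j$ with probability $p_{ij}$, where $p_{ij}\ge 0$, $p_{ii}=0$ and $\sum_j p_{ij}=1$. In a meeting of $i$ with $j$: with probability $\beta_{ij}$ both replace their beliefs by the average of the two; with probability $\alpha_{ij}$ agent $j$ influences agent $i$, so that $x_i$ becomes $\epsilon x_i+(1-\epsilon)x_j$ and $x_j$ is unchanged, where $\epsilon\in(0,1/2]$ is fixed; with probability $\gamma_{ij}=1-\alpha_{ij}-\beta_{ij}$ nothing changes. Here $\alpha_{ij},\beta_{ij},\gamma_{ij}\ge 0$. Thus $x(k+1)=W(k)x(k)$ with i.i.d. random matrices $W(k)$: with $A_{ij}=I-\tfrac12(e_i-e_j)(e_i-e_j)'$ and $J_{ij}=I-(1-\epsilon)e_i(e_i-e_j)'$, the matrix $W(k)$ is $A_{ij}$, $J_{ij}$, $I$ with respective probabilities $p_{ij}\beta_{ij}/n$, $p_{ij}\alpha_{ij}/n$, $p_{ij}\gamma_{ij}/n$. Assume that the directed graph with the links $\{(i,j): p_{ij}>0\}$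 is strongly connected, and that $\beta_{ij}+\alpha_{ij}>0$ whenever $p_{ij}>0$. Let $\tilde W=E[W(k)]$. The consensus distribution is the probability vector $\bar\pi$ with $\lim_{m\to\infty}\tilde W^m=e\bar\pi'$, where $e$ is the vector of ones; the excess influence of agent $k$ is $\bar\pi_k-\frac1n$. Let $$T=\frac1n\sum_{a,b}p_{ab}\big[(1-\gamma_{ab})A_{ab}+\gamma_{ab}I\big],$$ and let the social network graph be the undirected graph on the agents with edge set $\{\{a,b\}: T_{ab}>0\}$. An edge $\{i,j\}$ of it is essential if its removal disconnects $i$ from $j$; then $N(i,j)$ and $N(j,i)$ denote the connected components of $i$ and of $j$ after the removal. **Theorem.** Suppose that there is exactly one ordered pair of agents, $(i,j)$, with $\alpha_{ij}>0$, and that $\{i,j\}$ is an essential edge of the social network graph. Then $N(i,j)$ and $N(j,i)$ partition the set of agents, the consensus distribution exists and is unique, and for every agent $k$ $$\bar\pi_k-\frac1n=\frac{2}{n^2}\,\frac{\theta_{ij}(1-\epsilon)}{1-\frac{\theta_{ij}}{n}\big(|N(i,j)|-(1-2\epsilon)|N(j,i)|\big)}\,\Psi_{ij}(k),$$ where $$\theta_{ij}=\frac{p_{ij}\alpha_{ij}}{p_{ij}(1-\gamma_{ij})+p_{ji}(1-\gamma_{ji})},\qquad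 \Psi_{ij}(k)=\begin{cases}|N(i,j)|,& k\in N(j,i),\\ -|N(j,i)|,& k\in N(i,j),\end{cases}$$ and both denominators are positive. In particular, all agents in the same component have equal excess influence. -/

import Mathlib

open Filter Topology

/-- What happens when an agent `i` meets an agent `j`: they reach pairwise consensus, `j`
influences `i`, or they disagree and keep their beliefs. -/
inductive MeetingOutcome where
  | average
  | influence
  | disagree
  deriving DecidableEq

instance : Fintype MeetingOutcome where
  elems := {.average, .influence, .disagree}
  complete x := by cases x <;> simp

/-- The belief-evolution model on the agents `Fin n`, with the elementary constraints on its
parameters: meeting probabilities `p` (no self-meetings, rows are probability vectors),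
conditional probabilities `β` (averaging) and `α` (influence) of the outcomes of a meeting, and
the self-belief weight `ε ∈ (0, 1/2]`. In a meeting of `i` with `j`, `α i j` is the probability
that `j` influences `i`. -/
structure BeliefModel (n : ℕ) where
  p : Fin n → Fin n → ℝ
  α : Fin n → Fin n → ℝ
  β : Fin n → Fin n → ℝ
  ε : ℝ
  p_self : ∀ i, p i i = 0
  p_nonneg : ∀ i j, 0 ≤ p i j
  p_sum : ∀ i, ∑ j, p i j = 1
  α_nonneg : ∀ i j, 0 ≤ α i j
  β_nonneg : ∀ i j, 0 ≤ β i j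
  add_le_one : ∀ i j, β i j + α i j ≤ 1
  ε_pos : 0 < ε
  ε_le : ε ≤ 1 / 2

namespace BeliefModel

variable {n : ℕ} (M : BeliefModel n)

/-- The probability of disagreement in a meeting of `i` with `j`. -/
def γ (i j : Fin n) : ℝ := 1 - M.β i j - M.α i j

/-- The directed graph with the links `(i, j)`, `p i j > 0`, is strongly connected. -/
def StronglyConnected : Prop :=
  ∀ i j, Relation.ReflTransGen (fun a b => 0 < M.p a b) i j

/-- Along every link with positive meeting probability, information is exchanged with positive
probability. -/
def PositiveInteraction : Prop :=
  ∀ i j, 0 < M.p i j → 0 < M.β i j + M.α i j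

/-- The vector `e_i - e_j`. -/
def diffVec (i j : Fin n) : Fin n → ℝ := Pi.single i 1 - Pi.single j 1

/-- The averaging matrix `A_ij = I - (e_i - e_j)(e_i - e_j)ᵀ / 2`. -/
noncomputable def avgMatrix (i j : Fin n) : Matrix (Fin n) (Fin n) ℝ :=
  1 - (1 / 2 : ℝ) • Matrix.vecMulVec (diffVec i j) (diffVec i j)

/-- The matrix `J_ij = I - (1 - ε) e_i (e_i - e_j)ᵀ` of the event that `j` influences `i`. -/
noncomputable def influenceUpdate (i j : Fin n) : Matrix (Fin n) (Fin n) ℝ :=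
  1 - (1 - M.ε) • Matrix.vecMulVec (Pi.single i 1) (diffVec i j)

/-- The update matrix `W` as a function of the elementary event of a time slot: the active
agent, the agent it meets, and the outcome of the meeting. -/
noncomputable def updateMatrix :
    Fin n × Fin n × MeetingOutcome → Matrix (Fin n) (Fin n) ℝ
  | (i, j, .average) => avgMatrix i j
  | (i, j, .influence) => M.influenceUpdate i j
  | (_, _, .disagree) => 1

/-- The probability of an elementary event of a time slot. -/
noncomputable def eventProb : Fin n × Fin n × MeetingOutcome → ℝ
  | (i, j, .average) => M.p i j * M.β i j / n
  | (i, j, .influence) => M.p i j * M.α i j / n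
  | (i, j, .disagree) => M.p i j * M.γ i j / n

/-- The mean interaction matrix, i.e. the expectation of the random update matrix. -/
noncomputable def meanMatrix : Matrix (Fin n) (Fin n) ℝ :=
  ∑ ω, M.eventProb ω • M.updateMatrix ω

/-- The social network matrix `T`. -/
noncomputable def socialMatrix : Matrix (Fin n) (Fin n) ℝ :=
  (1 / n : ℝ) • ∑ i, ∑ j, M.p i j •
    ((1 - M.γ i j) • avgMatrix i j + M.γ i j • (1 : Matrix (Fin n) (Fin n) ℝ))

/-- The social network graph: the undirected graph with the edges `{i, j}`, `T i j > 0`. Since `T`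
is symmetric, the symmetrization done by `fromRel` changes nothing; loops, which are irrelevant
to connectivity, are dropped. -/
noncomputable def socialGraph : SimpleGraph (Fin n) :=
  SimpleGraph.fromRel fun i j => 0 < M.socialMatrix i j

/-- `{i, j}` is an essential edge of `G`: it is an edge of `G`, and its removal separates `i`
from `j`. -/
def IsEssentialEdge (G : SimpleGraph (Fin n)) (i j : Fin n) : Prop :=
  G.Adj i j ∧ ¬ (G.deleteEdges {s(i, j)}).Reachable i j

/-- `N(i, j)`: the component of `i` after the removal of the edge `{i, j}`. -/
def side (G : SimpleGraph (Fin n)) (i j : Fin n) : Set (Fin n) :=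
  {k | (G.deleteEdges {s(i, j)}).Reachable i k}

/-- `π` is the consensus distribution: the powers of the mean interaction matrix converge to the
matrix all of whose rows are `π`, and `π` is a probability vector. -/
def IsConsensusDistribution (π : Fin n → ℝ) : Prop :=
  π ∈ stdSimplex ℝ (Fin n) ∧
    Tendsto (fun m : ℕ => M.meanMatrix ^ m) atTop (𝓝 (Matrix.of fun _ k => π k))

/-- The excess influence of agent `k` with respect to the distribution `π`. -/
noncomputable def excessInfluence (π : Fin n → ℝ) (k : Fin n) : ℝ := π k - 1 / n

/-- `θ_ij`. -/
noncomputable def theta (i j : Fin n) : ℝ :=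
  M.p i j * M.α i j / (M.p i j * (1 - M.γ i j) + M.p j i * (1 - M.γ j i))

open Classical in
/-- `Ψ_ij(k)`: it is `|N(i, j)|` on `N(j, i)` and `-|N(j, i)|` on `N(i, j)`. -/
noncomputable def Psi (i j k : Fin n) : ℝ :=
  if k ∈ side M.socialGraph j i then ((side M.socialGraph i j).ncard : ℝ)
  else if k ∈ side M.socialGraph i j then -((side M.socialGraph j i).ncard : ℝ)
  else 0

end BeliefModel

/-! Acting on a row vector `x`, each meeting of `a` with `b` moves mass along `e_a - e_b`: averaging
moves `(x a - x b) / 2`, influence moves `(1 - ε) x a`. A vector is thus stationary for the mean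
matrix when its expected flows cancel. Since the forceful link is a bridge, one can take a vector
constant on each side. All flows inside a side then vanish, and only the net flow across the bridge
remains. After division by the total interaction rate of the bridge, its balance reads `(1 - θ) π_j
= (1 + θ (1 - 2ε)) π_i`, and normalization fixes both values (`vecMul_meanMatrix`,
`vecMul_meanMatrix_eq_self`).

The mean matrix is stochastic with positive diagonal, and strong connectivity makes it irreducible.
Its powers therefore converge to the rank-one matrix of any stationary probability vector
(`tendsto_pow_of_stationary`), so the explicit candidate is the consensus distribution; uniqueness
is uniqueness of limits. -/

open scoped Matrix

/-! ### Convergence of powers of stochastic matrices -/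

namespace Matrix

variable {ι : Type*} [Fintype ι] [DecidableEq ι]

theorem pow_succ_apply_pos {W : Matrix ι ι ℝ} (hW : ∀ a b, 0 ≤ W a b) {m : ℕ} {a b c : ι}
    (hab : 0 < (W ^ m) a b) (hbc : 0 < W b c) : 0 < (W ^ (m + 1)) a c := by
  rw [pow_succ, mul_apply]
  exact Finset.sum_pos' (fun d _ => mul_nonneg (pow_apply_nonneg hW m a d) (hW d c))
    ⟨b, Finset.mem_univ b, mul_pos hab hbc⟩

/-- An irreducible nonnegative matrix with positive diagonal is primitive. -/
theorem exists_pow_pos {W : Matrix ι ι ℝ} (hW : ∀ a b, 0 ≤ W a b) (hdiag : ∀ a, 0 < W a a)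
    (hirr : ∀ a b, Relation.ReflTransGen (fun c d => 0 < W c d) a b) :
    ∃ N : ℕ, ∀ a b, 0 < (W ^ N) a b := by
  have hex : ∀ a b, ∃ m : ℕ, 0 < (W ^ m) a b := by
    intro a b
    induction hirr a b with
    | refl => exact ⟨0, by simp⟩
    | tail _ hcd ih =>
      obtain ⟨m, hm⟩ := ih
      exact ⟨m + 1, pow_succ_apply_pos hW hm hcd⟩
  choose f hf using hex
  refine ⟨Finset.univ.sup fun ab : ι × ι => f ab.1 ab.2, fun a b => ?_⟩
  have hle : f a b ≤ Finset.univ.sup fun ab : ι × ι => f ab.1 ab.2 :=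
    Finset.le_sup (f := fun ab : ι × ι => f ab.1 ab.2) (Finset.mem_univ (a, b))
  exact Nat.le_induction (hf a b) (fun m _ h => pow_succ_apply_pos hW h (hdiag b)) _ hle

section Norm

attribute [local instance] Matrix.linftyOpNormedRing

theorem linfty_opNorm_le_of_row_sum_le {A : Matrix ι ι ℝ} {c : ℝ} (hc : 0 ≤ c)
    (h : ∀ a, ∑ b, |A a b| ≤ c) : ‖A‖ ≤ c := by
  rw [linfty_opNorm_def, ← Real.coe_toNNReal c hc, NNReal.coe_le_coe]
  refine Finset.sup_le fun a _ => ?_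
  rw [← NNReal.coe_le_coe, Real.coe_toNNReal c hc, NNReal.coe_sum]
  simpa using h a

/-- The powers of an irreducible stochastic matrix with positive diagonal converge to the
matrix all of whose rows are the stationary distribution. -/
theorem tendsto_pow_of_stationary [Nonempty ι] {W : Matrix ι ι ℝ} (hW : ∀ a b, 0 ≤ W a b)
    (hrow : ∀ a, ∑ b, W a b = 1) (hdiag : ∀ a, 0 < W a a)
    (hirr : ∀ a b, Relation.ReflTransGen (fun c d => 0 < W c d) a b) {π : ι → ℝ}
    (hπ : π ∈ stdSimplex ℝ ι) (hstat : π ᵥ* W = π) :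
    Tendsto (fun m : ℕ => W ^ m) atTop (𝓝 (Matrix.of fun _ k => π k)) := by
  set E : Matrix ι ι ℝ := Matrix.of fun _ k => π k with hE
  have hrow_mul : ∀ A : Matrix ι ι ℝ, ∀ a b, (A * E) a b = (∑ c, A a c) * π b := by
    intro A a b
    simp [hE, mul_apply, Finset.sum_mul]
  have hWE : W * E = E := by
    ext a b
    rw [hrow_mul, hrow, one_mul]; rfl
  have hEW : E * W = E := by
    ext a b
    exact congrFun hstat b
  have hEE : E * E = E := by
    ext a b
    rw [hrow_mul]
    simp [hE, hπ.2]
  have hpowE : ∀ m : ℕ, W ^ m * E = E := by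
    intro m
    induction m with
    | zero => simp
    | succ m ih => rw [pow_succ, mul_assoc, hWE, ih]
  have hEpow : ∀ m : ℕ, E * W ^ m = E := by
    intro m
    induction m with
    | zero => simp
    | succ m ih => rw [pow_succ, ← mul_assoc, ih, hEW]
  have hrowpow : ∀ (m : ℕ) (a : ι), ∑ b, (W ^ m) a b = 1 := by
    intro m
    induction m with
    | zero => intro a; simp [one_apply]
    | succ m ih =>
      intro a
      simp_rw [pow_succ, mul_apply]
      rw [Finset.sum_comm]
      simp_rw [← Finset.mul_sum, hrow, mul_one]
      exact ih a
  have hWnorm : ‖W‖ ≤ 1 := linfty_opNorm_le_of_row_sum_le zero_le_one fun a => by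
    simp_rw [abs_of_nonneg (hW a _)]
    exact (hrow a).le
  obtain ⟨N, hN⟩ := exists_pow_pos hW hdiag hirr
  obtain ⟨δ, hδ, hδle⟩ : ∃ δ : ℝ, 0 < δ ∧ ∀ a b, δ ≤ (W ^ N) a b := by
    obtain ⟨ab, -, hab⟩ := Finset.exists_min_image Finset.univ
      (fun ab : ι × ι => (W ^ N) ab.1 ab.2) Finset.univ_nonempty
    exact ⟨_, hN ab.1 ab.2, fun a b => hab (a, b) (Finset.mem_univ _)⟩
  have hπ1 : ∀ b, π b ≤ 1 := fun b => by
    rw [← hπ.2]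
    exact Finset.single_le_sum (fun c _ => hπ.1 c) (Finset.mem_univ b)
  -- Doeblin minorization: `W ^ N` dominates `δ • E` because `π ≤ 1`, and the remainder `Q` is
  -- nonnegative with row sums `1 - δ`, hence a strict contraction in the row-sum norm.
  set Q : Matrix ι ι ℝ := W ^ N - δ • E with hQ
  have hQnn : ∀ a b, 0 ≤ Q a b := by
    intro a b
    have h1 := hδle a b
    have h2 : δ * π b ≤ δ := mul_le_of_le_one_right hδ.le (hπ1 b)
    simp only [hQ, hE, sub_apply, smul_apply, of_apply, smul_eq_mul]
    linarith
  have hQrow : ∀ a, ∑ b, Q a b = 1 - δ := by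
    intro a
    simp only [hQ, hE, sub_apply, smul_apply, of_apply, smul_eq_mul, Finset.sum_sub_distrib,
      ← Finset.mul_sum, hrowpow, hπ.2, mul_one]
  have hδ1 : 0 ≤ 1 - δ := by
    obtain ⟨a⟩ := ‹Nonempty ι›
    rw [← hQrow a]
    exact Finset.sum_nonneg fun b _ => hQnn a b
  have hQnorm : ‖Q‖ ≤ 1 - δ := linfty_opNorm_le_of_row_sum_le hδ1 fun a => by
    simp_rw [abs_of_nonneg (hQnn a _)]
    exact (hQrow a).le
  -- `E` is idempotent and absorbs `W` on both sides, so `Q` agrees with `W ^ N` after right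
  -- multiplication by `1 - E`.
  have hstep : ∀ k : ℕ, W ^ (N * k) - E = Q ^ k * (1 - E) := by
    intro k
    induction k with
    | zero => simp
    | succ k ih =>
      have hcomm : (1 - E) * W ^ N = W ^ N - E := by rw [sub_mul, one_mul, hEpow]
      have hQ1 : Q * (1 - E) = W ^ N - E := by
        rw [hQ, sub_mul, mul_sub, hpowE, mul_one, smul_mul_assoc, mul_sub, mul_one, hEE, sub_self,
          smul_zero, sub_zero]
      calc W ^ (N * (k + 1)) - E = (W ^ (N * k) - E) * W ^ N := by
            rw [mul_add, mul_one, pow_add, sub_mul, hEpow]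
        _ = Q ^ (k + 1) * (1 - E) := by rw [ih, mul_assoc, hcomm, ← hQ1, ← mul_assoc, pow_succ]
  -- Monotonicity transfers the geometric decay from multiples of `N` to all exponents.
  have hanti : Antitone fun m : ℕ => ‖W ^ m - E‖ := antitone_nat_of_succ_le fun m => by
    have : W ^ (m + 1) - E = W * (W ^ m - E) := by rw [mul_sub, hWE, pow_succ']
    rw [this]
    exact (norm_mul_le _ _).trans (mul_le_of_le_one_left (norm_nonneg _) hWnorm)
  have hgeom : Tendsto (fun k : ℕ => (1 - δ) ^ k * ‖(1 : Matrix ι ι ℝ) - E‖) atTop (𝓝 0) := by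
    simpa using (tendsto_pow_atTop_nhds_zero_of_lt_one hδ1 (by linarith)).mul_const
      ‖(1 : Matrix ι ι ℝ) - E‖
  have hbound : ∀ k : ℕ, ‖W ^ (N * k) - E‖ ≤ (1 - δ) ^ k * ‖(1 : Matrix ι ι ℝ) - E‖ := by
    intro k
    rw [hstep]
    induction k with
    | zero => simp
    | succ k ih =>
      rw [pow_succ', mul_assoc, pow_succ', mul_assoc]
      exact (norm_mul_le _ _).trans (mul_le_mul hQnorm ih (norm_nonneg _) hδ1)
  refine tendsto_iff_norm_sub_tendsto_zero.mpr (Metric.tendsto_atTop.mpr ?_)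
  intro r hr
  obtain ⟨k, hk⟩ := (hgeom.eventually (gt_mem_nhds hr)).exists
  refine ⟨N * k, fun m hm => ?_⟩
  rw [Real.dist_eq, sub_zero, abs_of_nonneg (norm_nonneg _)]
  exact (hanti hm).trans_lt ((hbound k).trans_lt hk)

end Norm

end Matrix

/-! ### Update matrices and their action on row vectors -/

namespace BeliefModel

variable {n : ℕ}

theorem sum_diffVec (a b : Fin n) : ∑ c, diffVec a b c = 0 := by
  simp [diffVec, Finset.sum_sub_distrib]

theorem dotProduct_diffVec (x : Fin n → ℝ) (a b : Fin n) : x ⬝ᵥ diffVec a b = x a - x b := by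
  simp [diffVec, dotProduct_sub]

theorem diffVec_swap (a b : Fin n) : diffVec b a = -diffVec a b := by
  simp [diffVec]

theorem avgMatrix_apply (a b c d : Fin n) :
    avgMatrix a b c d = (if c = d then 1 else 0)
      - 1 / 2 * (((if c = a then 1 else 0) - if c = b then 1 else 0) *
        ((if d = a then 1 else 0) - if d = b then 1 else 0)) := by
  simp [avgMatrix, diffVec, Matrix.one_apply, Matrix.vecMulVec_apply, Pi.single_apply]

theorem avgMatrix_nonneg (a b c d : Fin n) : 0 ≤ avgMatrix a b c d := by
  rw [avgMatrix_apply]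
  split_ifs <;> first | (exfalso; omega) | norm_num

theorem avgMatrix_diag_pos (a b c : Fin n) : 0 < avgMatrix a b c c := by
  rw [avgMatrix_apply, if_pos rfl]
  split_ifs <;> norm_num

theorem avgMatrix_apply_self {a b : Fin n} (h : a ≠ b) : avgMatrix a b a b = 1 / 2 := by
  rw [avgMatrix_apply]
  simp [h, h.symm]

theorem sum_avgMatrix (a b c : Fin n) : ∑ d, avgMatrix a b c d = 1 := by
  simp [avgMatrix, Matrix.one_apply, Matrix.vecMulVec_apply, Finset.sum_sub_distrib,
    ← Finset.mul_sum, sum_diffVec]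

theorem vecMul_avgMatrix (x : Fin n → ℝ) (a b : Fin n) :
    x ᵥ* avgMatrix a b = x - ((1 / 2) * (x a - x b)) • diffVec a b := by
  rw [avgMatrix, Matrix.vecMul_sub, Matrix.vecMul_one, Matrix.vecMul_smul,
    Matrix.vecMul_vecMulVec, dotProduct_diffVec, smul_smul]

variable (M : BeliefModel n)

theorem influenceUpdate_apply (a b c d : Fin n) :
    M.influenceUpdate a b c d = (if c = d then 1 else 0)
      - (1 - M.ε) * ((if c = a then 1 else 0) *
        ((if d = a then 1 else 0) - if d = b then 1 else 0)) := by
  simp [influenceUpdate, diffVec, Matrix.one_apply, Matrix.vecMulVec_apply, Pi.single_apply]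

theorem influenceUpdate_nonneg (a b c d : Fin n) : 0 ≤ M.influenceUpdate a b c d := by
  have h1 := M.ε_pos
  have h2 := M.ε_le
  rw [influenceUpdate_apply]
  split_ifs <;> first | (exfalso; omega) | linarith

theorem influenceUpdate_diag_pos (a b c : Fin n) : 0 < M.influenceUpdate a b c c := by
  have h1 := M.ε_pos
  have h2 := M.ε_le
  rw [influenceUpdate_apply, if_pos rfl]
  split_ifs <;> linarith

theorem influenceUpdate_apply_self {a b : Fin n} (h : a ≠ b) :
    M.influenceUpdate a b a b = 1 - M.ε := by
  rw [influenceUpdate_apply]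
  simp [h, h.symm]

theorem sum_influenceUpdate (a b c : Fin n) : ∑ d, M.influenceUpdate a b c d = 1 := by
  simp [influenceUpdate, Matrix.one_apply, Matrix.vecMulVec_apply, Finset.sum_sub_distrib,
    ← Finset.mul_sum, sum_diffVec]

theorem vecMul_influenceUpdate (x : Fin n → ℝ) (a b : Fin n) :
    x ᵥ* M.influenceUpdate a b = x - ((1 - M.ε) * x a) • diffVec a b := by
  rw [influenceUpdate, Matrix.vecMul_sub, Matrix.vecMul_one, Matrix.vecMul_smul,
    Matrix.vecMul_vecMulVec, dotProduct_single, mul_one, smul_smul]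

/-! ### The mean matrix: stochasticity, irreducibility, flow balance -/

theorem γ_nonneg (a b : Fin n) : 0 ≤ M.γ a b := by
  have := M.add_le_one a b
  unfold γ
  linarith

theorem eventProb_nonneg (ω : Fin n × Fin n × MeetingOutcome) : 0 ≤ M.eventProb ω := by
  obtain ⟨a, b, _ | _ | _⟩ := ω
  · exact div_nonneg (mul_nonneg (M.p_nonneg a b) (M.β_nonneg a b)) (Nat.cast_nonneg n)
  · exact div_nonneg (mul_nonneg (M.p_nonneg a b) (M.α_nonneg a b)) (Nat.cast_nonneg n)
  · exact div_nonneg (mul_nonneg (M.p_nonneg a b) (M.γ_nonneg a b)) (Nat.cast_nonneg n)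

theorem updateMatrix_nonneg (ω : Fin n × Fin n × MeetingOutcome) (c d : Fin n) :
    0 ≤ M.updateMatrix ω c d := by
  obtain ⟨a, b, _ | _ | _⟩ := ω
  · exact avgMatrix_nonneg a b c d
  · exact M.influenceUpdate_nonneg a b c d
  · simp only [updateMatrix, Matrix.one_apply]
    split_ifs <;> norm_num

theorem updateMatrix_diag_pos (ω : Fin n × Fin n × MeetingOutcome) (c : Fin n) :
    0 < M.updateMatrix ω c c := by
  obtain ⟨a, b, _ | _ | _⟩ := ω
  · exact avgMatrix_diag_pos a b c
  · exact M.influenceUpdate_diag_pos a b c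
  · simp [updateMatrix]

theorem sum_updateMatrix (ω : Fin n × Fin n × MeetingOutcome) (c : Fin n) :
    ∑ d, M.updateMatrix ω c d = 1 := by
  obtain ⟨a, b, _ | _ | _⟩ := ω
  · exact sum_avgMatrix a b c
  · exact M.sum_influenceUpdate a b c
  · simp [updateMatrix, Matrix.one_apply]

theorem sum_event {E : Type*} [AddCommMonoid E] (f : Fin n × Fin n × MeetingOutcome → E) :
    ∑ ω, f ω = ∑ a, ∑ b, (f (a, b, .average) + f (a, b, .influence) + f (a, b, .disagree)) := by
  have h : ∀ g : MeetingOutcome → E, ∑ o, g o = g .average + g .influence + g .disagree := by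
    intro g
    change ∑ o ∈ {MeetingOutcome.average, .influence, .disagree}, g o = _
    rw [Finset.sum_insert (by decide), Finset.sum_insert (by decide), Finset.sum_singleton,
      add_assoc]
  simp_rw [Fintype.sum_prod_type, h]

theorem sum_eventProb [NeZero n] : ∑ ω, M.eventProb ω = 1 := by
  have hn : (n : ℝ) ≠ 0 := Nat.cast_ne_zero.mpr (NeZero.ne n)
  have h : ∀ a b, M.eventProb (a, b, .average) + M.eventProb (a, b, .influence)
      + M.eventProb (a, b, .disagree) = M.p a b / n := by
    intro a b
    simp only [eventProb, γ]
    ring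
  simp_rw [sum_event, h, ← Finset.sum_div, M.p_sum]
  simp [hn]

theorem meanMatrix_apply (c d : Fin n) :
    M.meanMatrix c d = ∑ ω, M.eventProb ω * M.updateMatrix ω c d := by
  simp [meanMatrix, Matrix.sum_apply]

theorem meanMatrix_nonneg (c d : Fin n) : 0 ≤ M.meanMatrix c d := by
  rw [meanMatrix_apply]
  exact Finset.sum_nonneg fun ω _ => mul_nonneg (M.eventProb_nonneg ω) (M.updateMatrix_nonneg ω c d)

theorem meanMatrix_pos_of_event {ω : Fin n × Fin n × MeetingOutcome} {c d : Fin n}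
    (h1 : 0 < M.eventProb ω) (h2 : 0 < M.updateMatrix ω c d) : 0 < M.meanMatrix c d := by
  rw [meanMatrix_apply]
  exact Finset.sum_pos'
    (fun ω _ => mul_nonneg (M.eventProb_nonneg ω) (M.updateMatrix_nonneg ω c d))
    ⟨ω, Finset.mem_univ ω, mul_pos h1 h2⟩

theorem sum_meanMatrix [NeZero n] (c : Fin n) : ∑ d, M.meanMatrix c d = 1 := by
  simp_rw [meanMatrix_apply]
  rw [Finset.sum_comm]
  simp_rw [← Finset.mul_sum, sum_updateMatrix, mul_one, sum_eventProb]

theorem meanMatrix_diag_pos [NeZero n] (c : Fin n) : 0 < M.meanMatrix c c := by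
  -- Total probability one forces some event to have positive probability, and every update matrix
  -- has positive diagonal.
  obtain ⟨ω, -, hω⟩ : ∃ ω ∈ Finset.univ, 0 < M.eventProb ω := by
    refine Finset.exists_lt_of_sum_lt (f := fun _ => (0 : ℝ)) ?_
    rw [sum_eventProb]
    simp
  exact M.meanMatrix_pos_of_event hω (M.updateMatrix_diag_pos ω c)

variable {M}

theorem ne_of_p_pos {a b : Fin n} (h : 0 < M.p a b) : a ≠ b := by
  rintro rfl
  rw [M.p_self] at h
  exact lt_irrefl _ h

theorem PositiveInteraction.meanMatrix_pos [NeZero n] (hint : M.PositiveInteraction)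
    {a b : Fin n} (h : 0 < M.p a b) : 0 < M.meanMatrix a b := by
  have hn : (0 : ℝ) < n := Nat.cast_pos.mpr (NeZero.pos n)
  have hab := ne_of_p_pos h
  rcases (M.β_nonneg a b).lt_or_eq with hβ | hβ
  · refine M.meanMatrix_pos_of_event (ω := (a, b, .average)) (div_pos (mul_pos h hβ) hn) ?_
    simp only [updateMatrix, avgMatrix_apply_self hab]
    norm_num
  · have hα : 0 < M.α a b := by
      have := hint a b h
      linarith
    refine M.meanMatrix_pos_of_event (ω := (a, b, .influence)) (div_pos (mul_pos h hα) hn) ?_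
    simp only [updateMatrix, influenceUpdate_apply_self M hab]
    linarith [M.ε_le]

/-- A stationary probability vector of the mean interaction matrix is the consensus
distribution. -/
theorem isConsensusDistribution_of_stationary [NeZero n] (hconn : M.StronglyConnected)
    (hint : M.PositiveInteraction) {π : Fin n → ℝ} (hπ : π ∈ stdSimplex ℝ (Fin n))
    (hstat : π ᵥ* M.meanMatrix = π) : M.IsConsensusDistribution π :=
  ⟨hπ, Matrix.tendsto_pow_of_stationary M.meanMatrix_nonneg M.sum_meanMatrix M.meanMatrix_diag_pos
    (fun a b => (hconn a b).lift id fun _ _ h => hint.meanMatrix_pos h) hπ hstat⟩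

theorem IsConsensusDistribution.unique [NeZero n] {π π' : Fin n → ℝ}
    (h : M.IsConsensusDistribution π) (h' : M.IsConsensusDistribution π') : π = π' :=
  congrFun (Matrix.of.injective (tendsto_nhds_unique h.2 h'.2)) 0

/-- The balance of a vector under one step of the mean interaction matrix. -/
theorem vecMul_meanMatrix [NeZero n] (x : Fin n → ℝ) :
    x ᵥ* M.meanMatrix = x - (1 / n : ℝ) • ∑ a, ∑ b,
      (M.p a b * (M.β a b * (1 / 2 * (x a - x b)) + M.α a b * ((1 - M.ε) * x a))) •
        diffVec a b := by
  have h : x ᵥ* M.meanMatrix = ∑ ω, (M.eventProb ω • x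
      - M.eventProb ω • (x - x ᵥ* M.updateMatrix ω)) := by
    simp_rw [← smul_sub, sub_sub_cancel]
    simp [meanMatrix, Matrix.vecMul_sum, Matrix.vecMul_smul]
  rw [h, Finset.sum_sub_distrib, ← Finset.sum_smul, sum_eventProb, one_smul, sum_event,
    Finset.smul_sum]
  simp_rw [Finset.smul_sum]
  congr 1
  refine Finset.sum_congr rfl fun a _ => Finset.sum_congr rfl fun b _ => ?_
  simp only [updateMatrix, eventProb, vecMul_avgMatrix, vecMul_influenceUpdate, Matrix.vecMul_one,
    sub_sub_cancel, sub_self, smul_zero, add_zero, smul_smul, ← add_smul]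
  congr 1
  ring

/-! ### The social graph and the two sides of an edge -/

/-- Off the diagonal the identity terms vanish and the averaging terms are nonnegative, so the
meeting of `a` with `b` alone suffices. Hence directed meeting paths are walks in the social graph.
-/
theorem socialMatrix_pos [NeZero n] (hint : M.PositiveInteraction) {a b : Fin n}
    (h : 0 < M.p a b) : 0 < M.socialMatrix a b := by
  have hn : (0 : ℝ) < n := Nat.cast_pos.mpr (NeZero.pos n)
  have hab := ne_of_p_pos h
  have hnn : ∀ c d, 0 ≤ M.p c d * ((1 - M.γ c d) * avgMatrix c d a b) := by
    intro c d
    have h1 := M.α_nonneg c d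
    have h2 := M.β_nonneg c d
    exact mul_nonneg (M.p_nonneg c d)
      (mul_nonneg (by unfold γ; linarith) (avgMatrix_nonneg c d a b))
  have hval : M.socialMatrix a b =
      1 / n * ∑ c, ∑ d, M.p c d * ((1 - M.γ c d) * avgMatrix c d a b) := by
    simp [socialMatrix, Matrix.sum_apply, Matrix.one_apply_ne hab]
  rw [hval]
  refine mul_pos (by positivity) ?_
  refine Finset.sum_pos' (fun c _ => Finset.sum_nonneg fun d _ => hnn c d)
    ⟨a, Finset.mem_univ a, Finset.sum_pos' (fun d _ => hnn a d) ⟨b, Finset.mem_univ b, ?_⟩⟩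
  have h1 := hint a b h
  rw [avgMatrix_apply_self hab]
  exact mul_pos h (mul_pos (by unfold γ; linarith) (by norm_num))

theorem socialGraph_adj [NeZero n] (hint : M.PositiveInteraction) {a b : Fin n}
    (h : 0 < M.p a b) : M.socialGraph.Adj a b :=
  (SimpleGraph.fromRel_adj _ a b).mpr ⟨ne_of_p_pos h, Or.inl (socialMatrix_pos hint h)⟩

theorem mem_side_self (G : SimpleGraph (Fin n)) (i j : Fin n) : i ∈ side G i j :=
  SimpleGraph.Reachable.refl i

theorem side_swap_eq (G : SimpleGraph (Fin n)) (i j : Fin n) :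
    side G j i = {k | (G.deleteEdges {s(i, j)}).Reachable j k} := by
  rw [side, Sym2.eq_swap]

theorem IsEssentialEdge.disjoint_side {G : SimpleGraph (Fin n)} {i j : Fin n}
    (h : IsEssentialEdge G i j) : Disjoint (side G i j) (side G j i) := by
  rw [side_swap_eq G i j, Set.disjoint_left]
  exact fun k (hi : SimpleGraph.Reachable _ i k) hj => h.2 (hi.trans (SimpleGraph.Reachable.symm hj))

/-- A link of the graph between two agents either is `{i, j}` or stays inside a side. -/
theorem mem_side_iff_of_adj {G : SimpleGraph (Fin n)} {i j a b : Fin n} (hab : G.Adj a b)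
    (hne : s(a, b) ≠ s(i, j)) : a ∈ side G i j ↔ b ∈ side G i j := by
  have hadj : (G.deleteEdges {s(i, j)}).Adj a b := by
    rw [SimpleGraph.deleteEdges_adj]
    exact ⟨hab, hne⟩
  exact ⟨fun h => h.trans hadj.reachable, fun h => h.trans hadj.symm.reachable⟩

/-- Along a path of links from `i`, every link keeps its side except `{i, j}` itself, which ends at
`i` or `j`. -/
theorem side_union_side [NeZero n] (hconn : M.StronglyConnected) (hint : M.PositiveInteraction)
    (i j : Fin n) : side M.socialGraph i j ∪ side M.socialGraph j i = Set.univ := by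
  refine Set.eq_univ_of_forall fun k => ?_
  induction hconn i k with
  | refl => exact Or.inl (mem_side_self _ i j)
  | @tail b c _ hbc ih =>
    have hadj := socialGraph_adj hint hbc
    by_cases he : s(b, c) = s(i, j)
    · rcases Sym2.eq_iff.mp he with ⟨-, rfl⟩ | ⟨-, rfl⟩
      · exact Or.inr (mem_side_self _ c i)
      · exact Or.inl (mem_side_self _ c j)
    · have he' : s(b, c) ≠ s(j, i) := by rwa [Sym2.eq_swap (a := j)]
      exact ih.imp (mem_side_iff_of_adj hadj he).mp (mem_side_iff_of_adj hadj he').mp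

/-- The two agents of an essential edge exchange information with positive probability. -/
theorem IsEssentialEdge.interaction_pos [NeZero n] (hconn : M.StronglyConnected)
    (hint : M.PositiveInteraction) {i j : Fin n} (h : IsEssentialEdge M.socialGraph i j) :
    0 < M.p i j * (1 - M.γ i j) + M.p j i * (1 - M.γ j i) := by
  have hq : ∀ a b, 0 ≤ M.p a b * (1 - M.γ a b) ∧
      (0 < M.p a b → 0 < M.p a b * (1 - M.γ a b)) := fun a b => by
    have heq : 1 - M.γ a b = M.β a b + M.α a b := by unfold γ; ring
    rw [heq]
    exact ⟨mul_nonneg (M.p_nonneg a b) (add_nonneg (M.β_nonneg a b) (M.α_nonneg a b)),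
      fun hp => mul_pos hp (hint a b hp)⟩
  by_contra hcon
  have hpij : ¬0 < M.p i j := fun hp => hcon (add_pos_of_pos_of_nonneg ((hq i j).2 hp) (hq j i).1)
  have hpji : ¬0 < M.p j i := fun hp => hcon (add_pos_of_nonneg_of_pos (hq i j).1 ((hq j i).2 hp))
  -- If `i` and `j` never met, no path from `i` could leave its side, so `j` would lie in it.
  have hmem : ∀ k, k ∈ side M.socialGraph i j := by
    intro k
    induction hconn i k with
    | refl => exact mem_side_self _ i j
    | @tail b c _ hbc ih =>
      refine (mem_side_iff_of_adj (socialGraph_adj hint hbc) fun he => ?_).mp ih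
      rcases Sym2.eq_iff.mp he with ⟨rfl, rfl⟩ | ⟨rfl, rfl⟩
      · exact hpij hbc
      · exact hpji hbc
  exact h.2 (hmem j)

/-- A vector that is constant on both sides of the link `{i, j}` and balanced across it is
stationary. -/
theorem vecMul_meanMatrix_eq_self [NeZero n] {i j : Fin n}
    (hij : i ≠ j) (hforce : ∀ a b, 0 < M.α a b ↔ a = i ∧ b = j) {x : Fin n → ℝ}
    (hx : ∀ a b, 0 < M.p a b → s(a, b) ≠ s(i, j) → x a = x b)
    (hbal : M.p i j * (M.β i j * (1 / 2 * (x i - x j)) + M.α i j * ((1 - M.ε) * x i))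
      = M.p j i * (M.β j i * (1 / 2 * (x j - x i)))) :
    x ᵥ* M.meanMatrix = x := by
  set f : Fin n × Fin n → Fin n → ℝ := fun ab =>
    (M.p ab.1 ab.2 * (M.β ab.1 ab.2 * (1 / 2 * (x ab.1 - x ab.2))
      + M.α ab.1 ab.2 * ((1 - M.ε) * x ab.1))) • diffVec ab.1 ab.2 with hf
  have hα : ∀ a b, ¬(a = i ∧ b = j) → M.α a b = 0 := fun a b h =>
    le_antisymm (not_lt.mp fun h' => h ((hforce a b).mp h')) (M.α_nonneg a b)
  have hzero : ∑ ab, f ab = 0 := by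
    -- Only the two orientations of the bridge can carry flow. For any other pair, either `p`
    -- vanishes, or the values agree and there is no influence.
    have hne : (i, j) ≠ (j, i) := fun h => hij (Prod.ext_iff.mp h).1
    rw [← Finset.sum_subset (Finset.subset_univ {(i, j), (j, i)}), Finset.sum_pair hne]
    · simp only [hf]
      rw [diffVec_swap i j, hbal, hα j i fun h => hij h.2, smul_neg, zero_mul, add_zero,
        add_neg_cancel]
    · rintro ⟨a, b⟩ - hab
      simp only [Finset.mem_insert, Finset.mem_singleton, Prod.mk.injEq, not_or] at hab
      rcases (M.p_nonneg a b).lt_or_eq with hp | hp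
      · have hs : s(a, b) ≠ s(i, j) := fun h => (Sym2.eq_iff.mp h).elim hab.1 hab.2
        simp [hf, hα a b hab.1, hx a b hp hs]
      · simp [hf, ← hp]
  rw [Fintype.sum_prod_type] at hzero
  rw [vecMul_meanMatrix]
  simp only [hf] at hzero
  rw [hzero, smul_zero, sub_zero]

/-- The weight `θ_ij` is at most one. -/
theorem theta_le_one {i j : Fin n} (hd : 0 < M.p i j * (1 - M.γ i j) + M.p j i * (1 - M.γ j i)) :
    M.theta i j ≤ 1 := by
  have h1 := mul_nonneg (M.p_nonneg i j) (M.β_nonneg i j)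
  have h2 := mul_nonneg (M.p_nonneg j i) (add_nonneg (M.α_nonneg j i) (M.β_nonneg j i))
  rw [theta, div_le_one hd]
  unfold γ
  linarith

theorem theta_nonneg {i j : Fin n} (hd : 0 < M.p i j * (1 - M.γ i j) + M.p j i * (1 - M.γ j i)) :
    0 ≤ M.theta i j :=
  div_nonneg (mul_nonneg (M.p_nonneg i j) (M.α_nonneg i j)) hd.le

theorem IsEssentialEdge.Psi_of_mem_left {i j : Fin n} (h : IsEssentialEdge M.socialGraph i j)
    {k : Fin n} (hk : k ∈ side M.socialGraph i j) :
    M.Psi i j k = -((side M.socialGraph j i).ncard : ℝ) := by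
  rw [Psi, if_neg (Set.disjoint_left.mp h.disjoint_side hk), if_pos hk]

theorem Psi_of_mem_right {i j k : Fin n} (hk : k ∈ side M.socialGraph j i) :
    M.Psi i j k = ((side M.socialGraph i j).ncard : ℝ) := by
  rw [Psi, if_pos hk]

/-- The two sides contribute opposite products of their sizes; this gives the candidate distribution
total mass one. -/
theorem sum_Psi {i j : Fin n} (h : IsEssentialEdge M.socialGraph i j)
    (hu : side M.socialGraph i j ∪ side M.socialGraph j i = Set.univ) :
    ∑ k, M.Psi i j k = 0 := by
  classical
  have hcompl : ∀ k, k ∉ side M.socialGraph i j ↔ k ∈ side M.socialGraph j i := fun k =>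
    ⟨fun hk => (hu.ge (Set.mem_univ k)).resolve_left hk,
      fun hk hk' => Set.disjoint_left.mp h.disjoint_side hk' hk⟩
  have h1 : ∀ k, M.Psi i j k =
      (if k ∈ side M.socialGraph j i then ((side M.socialGraph i j).ncard : ℝ) else 0)
        - if k ∈ side M.socialGraph i j then ((side M.socialGraph j i).ncard : ℝ) else 0 := by
    intro k
    by_cases hk : k ∈ side M.socialGraph i j
    · rw [h.Psi_of_mem_left hk, if_neg (Set.disjoint_left.mp h.disjoint_side hk), if_pos hk,
        zero_sub]
    · rw [Psi_of_mem_right ((hcompl k).mp hk), if_pos ((hcompl k).mp hk), if_neg hk, sub_zero]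
  have hcard : ∀ S : Set (Fin n), (Finset.univ.filter (· ∈ S)).card = S.ncard := by
    intro S
    rw [← Set.ncard_coe_finset]
    simp
  simp_rw [h1, Finset.sum_sub_distrib, ← Finset.sum_filter, Finset.sum_const, hcard, nsmul_eq_mul]
  ring

end BeliefModel

/-! ### The explicit stationary distribution -/

/-- One forceful link, on an essential edge: the excess influence of every agent. -/
theorem theorem8 {n : ℕ} (M : BeliefModel n)
    (hconn : M.StronglyConnected) (hint : M.PositiveInteraction)
    (i j : Fin n) (hforce : ∀ a b, 0 < M.α a b ↔ a = i ∧ b = j)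
    (hess : BeliefModel.IsEssentialEdge M.socialGraph i j) :
    (Disjoint (BeliefModel.side M.socialGraph i j) (BeliefModel.side M.socialGraph j i) ∧
      BeliefModel.side M.socialGraph i j ∪ BeliefModel.side M.socialGraph j i = Set.univ) ∧
    0 < M.p i j * (1 - M.γ i j) + M.p j i * (1 - M.γ j i) ∧
    0 < 1 - M.theta i j / n * (((BeliefModel.side M.socialGraph i j).ncard : ℝ)
          - (1 - 2 * M.ε) * ((BeliefModel.side M.socialGraph j i).ncard : ℝ)) ∧
    (∃! π : Fin n → ℝ, M.IsConsensusDistribution π) ∧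
    ∀ π : Fin n → ℝ, M.IsConsensusDistribution π →
      (∀ k, BeliefModel.excessInfluence π k =
        2 / (n : ℝ) ^ 2 *
          (M.theta i j * (1 - M.ε) /
            (1 - M.theta i j / n * (((BeliefModel.side M.socialGraph i j).ncard : ℝ)
              - (1 - 2 * M.ε) * ((BeliefModel.side M.socialGraph j i).ncard : ℝ)))) *
          M.Psi i j k) ∧
      (∀ k l, ((k ∈ BeliefModel.side M.socialGraph i j ∧ l ∈ BeliefModel.side M.socialGraph i j) ∨
          (k ∈ BeliefModel.side M.socialGraph j i ∧ l ∈ BeliefModel.side M.socialGraph j i)) →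
        BeliefModel.excessInfluence π k = BeliefModel.excessInfluence π l) := by
  have : NeZero n := ⟨fun h => (h ▸ i).elim0⟩
  have hn : (0 : ℝ) < n := Nat.cast_pos.mpr (NeZero.pos n)
  have hij : i ≠ j := hess.1.ne
  have hα : 0 < M.α i j := (hforce i j).mpr ⟨rfl, rfl⟩
  have hαji : M.α j i = 0 :=
    le_antisymm (not_lt.mp fun h => hij ((hforce j i).mp h).2) (M.α_nonneg j i)
  have hdisj := hess.disjoint_side
  have hunion := BeliefModel.side_union_side hconn hint i j
  have hcard : ((BeliefModel.side M.socialGraph i j).ncard : ℝ)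
      + ((BeliefModel.side M.socialGraph j i).ncard : ℝ) = n := by
    rw [← Nat.cast_add, ← Set.ncard_union_eq hdisj, hunion, Set.ncard_univ, Nat.card_fin]
  have hPsi_i := hess.Psi_of_mem_left (BeliefModel.mem_side_self _ i j)
  have hPsi_j := BeliefModel.Psi_of_mem_right (M := M) (BeliefModel.mem_side_self _ j i)
  have hsum := BeliefModel.sum_Psi hess hunion
  have hd : 0 < M.p i j * (1 - M.γ i j) + M.p j i * (1 - M.γ j i) :=
    hess.interaction_pos hconn hint
  have hθ0 := BeliefModel.theta_nonneg hd
  have hθ1 := BeliefModel.theta_le_one hd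
  have hθ : M.theta i j * (M.p i j * (1 - M.γ i j) + M.p j i * (1 - M.γ j i))
      = M.p i j * M.α i j := div_mul_cancel₀ _ hd.ne'
  have hside : ∀ k, k ∈ BeliefModel.side M.socialGraph i j ∨
      k ∈ BeliefModel.side M.socialGraph j i := fun k =>
    hunion.ge (Set.mem_univ k)
  have hPsi_l : ∀ k ∈ BeliefModel.side M.socialGraph i j, M.Psi i j k = M.Psi i j i :=
    fun k hk => (hess.Psi_of_mem_left hk).trans hPsi_i.symm
  have hPsi_r : ∀ k ∈ BeliefModel.side M.socialGraph j i, M.Psi i j k = M.Psi i j j :=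
    fun k hk => (BeliefModel.Psi_of_mem_right hk).trans hPsi_j.symm
  have hs : 0 < ((BeliefModel.side M.socialGraph j i).ncard : ℝ) := by
    rw [Nat.cast_pos, Set.ncard_pos]
    exact ⟨j, BeliefModel.mem_side_self _ j i⟩
  have hr : 0 ≤ ((BeliefModel.side M.socialGraph i j).ncard : ℝ) := Nat.cast_nonneg _
  have hε0 := M.ε_pos
  have hε1 := M.ε_le
  set r : ℝ := ((BeliefModel.side M.socialGraph i j).ncard : ℝ)
  set s : ℝ := ((BeliefModel.side M.socialGraph j i).ncard : ℝ)
  set θ := M.theta i j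
  -- Strictness comes from `θ r ≤ r < n`: the side of `j` is nonempty.
  have hden : 0 < 1 - θ / n * (r - (1 - 2 * M.ε) * s) := by
    have h1 : θ * (r - (1 - 2 * M.ε) * s) < n := by
      have h2 : 0 ≤ (1 - 2 * M.ε) * s := mul_nonneg (by linarith) hs.le
      have h3 : θ * r ≤ r := mul_le_of_le_one_left hr hθ1
      have h4 := mul_nonneg hθ0 h2
      linarith
    have h5 : θ / n * (r - (1 - 2 * M.ε) * s) < 1 := by
      rw [div_mul_eq_mul_div, div_lt_one hn]
      exact h1
    linarith
  set D := 1 - θ / n * (r - (1 - 2 * M.ε) * s) with hD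
  have hnD : n * D = n - θ * (r - (1 - 2 * M.ε) * s) := by
    rw [hD]
    field_simp
  set π : Fin n → ℝ := fun k => 1 / n + 2 / (n : ℝ) ^ 2 * (θ * (1 - M.ε) / D) * M.Psi i j k
    with hπdef
  -- In this form nonnegativity is visible, from `θ ≤ 1` here and `ε ≤ 1 / 2` for `π j`. The common
  -- denominator is `n D = r (1 - θ) + s (1 + θ (1 - 2ε))`, by `r + s = n`.
  have hπi : π i = (1 - θ) / (n * D) := by
    have h : π i = (n * D - 2 * θ * (1 - M.ε) * s) / (n * (n * D)) := by
      simp only [hπdef, hPsi_i]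
      field_simp
      ring
    rw [h, div_eq_div_iff (by positivity) (by positivity), hnD, ← hcard]
    ring
  have hπj : π j = (1 + θ * (1 - 2 * M.ε)) / (n * D) := by
    have h : π j = (n * D + 2 * θ * (1 - M.ε) * r) / (n * (n * D)) := by
      simp only [hπdef, hPsi_j]
      field_simp
    rw [h, div_eq_div_iff (by positivity) (by positivity), hnD, ← hcard]
    ring
  have hπl : ∀ k ∈ BeliefModel.side M.socialGraph i j, π k = π i := fun k hk => by
    simp only [hπdef, hPsi_l k hk]
  have hπr : ∀ k ∈ BeliefModel.side M.socialGraph j i, π k = π j := fun k hk => by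
    simp only [hπdef, hPsi_r k hk]
  have hπi0 : 0 ≤ π i := by
    rw [hπi]
    exact div_nonneg (by linarith) (by positivity)
  have hπj0 : 0 ≤ π j := by
    rw [hπj]
    have := mul_nonneg hθ0 (by linarith : 0 ≤ 1 - 2 * M.ε)
    exact div_nonneg (by linarith) (by positivity)
  have hsimplex : π ∈ stdSimplex ℝ (Fin n) := by
    refine ⟨fun k => ?_, ?_⟩
    · rcases hside k with hk | hk
      · rw [hπl k hk]; exact hπi0
      · rw [hπr k hk]; exact hπj0
    · simp only [hπdef]
      rw [Finset.sum_add_distrib, ← Finset.mul_sum, hsum]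
      simp [hn.ne']
  have hstat : π ᵥ* M.meanMatrix = π := by
    refine BeliefModel.vecMul_meanMatrix_eq_self hij hforce (fun a b hp hne => ?_) ?_
    · have hmem := BeliefModel.mem_side_iff_of_adj (BeliefModel.socialGraph_adj hint hp) hne
      rcases hside a with ha | ha
      · rw [hπl a ha, hπl b (hmem.mp ha)]
      · have hb : b ∈ BeliefModel.side M.socialGraph j i := (hside b).resolve_left fun hb =>
          Set.disjoint_left.mp hdisj (hmem.mpr hb) ha
        rw [hπr a ha, hπr b hb]
    -- With the denominators cleared, balance across the bridge is a multiple of the defining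
    -- relation of `θ`, using `α j i = 0`.
    · rw [hπi, hπj]
      simp only [BeliefModel.γ, hαji] at hθ
      field_simp
      linear_combination (1 - M.ε) * (-2) * hθ
  have hcons := BeliefModel.isConsensusDistribution_of_stationary hconn hint hsimplex hstat
  refine ⟨⟨hdisj, hunion⟩, hd, hden, ⟨π, hcons, fun π' h => h.unique hcons⟩, fun π' h => ?_⟩
  obtain rfl := h.unique hcons
  refine ⟨fun k => add_sub_cancel_left _ _, fun k l hkl => ?_⟩
  unfold BeliefModel.excessInfluence
  rcases hkl with ⟨hk, hl⟩ | ⟨hk, hl⟩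
  · rw [hπl k hk, hπl l hl]
  · rw [hπr k hk, hπr l hl]
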